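/- All matroids have finite ground sets. For a matroid $M$ on $E$, let $P(M)\subset\mathbb R^{E}$ be its base polytope, the convex hull of the incidence vectors $\sum_{i\in B}e_i$ of the bases $B$ of $M$. A decomposition of $P(M)$ is an expression $P(M)=\bigcup_{i=1}^{t}P(N_i)$, where $N_1,\dots,N_t$ are matroids on $E$ and, for all $i\ne j$, $P(N_i)\cap P(N_j)$ is a (possibly empty) face of both $P(N_i)$ and $P(N_j)$. A hyperplane split of $P(M)$ is a decomposition $P(M)=P(N_1)\cup P(N_2)$ into two pieces, both different from $P(M)$. A sequence of $k\ge 1$ hyperplane splits of $P(M)$ starts with the single piece $P(M)$ and in each of $k$ steps replaces one of the current pieces $P(N)$ by the two pieces of a hyperplane split of $P(N)$, such that the $k+1$ pieces obtained at the end form a decomposition of $P(M)$. **Theorem.** Let $M_1$ and $M_2$ be matroids on disjoint finite ground sets $E_1$ and $E_2$, and let $M_1\oplus M_2$ be their direct sum, the matroid on $E_1\cup E_2$ whose bases are the sets $B_1\cup B_2$ with $B_i$ a basis of $M_i$. If $P(M_1)$ or $P(M_2)$ admits a sequence of hyperplane splits, then so does $P(M_1\oplus M_2)$. More precisely, replacing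 every piece $P(N)$ by $P(N\oplus M_2)$ at each stage of a sequence of $k$ hyperplane splits of $P(M_1)$ gives a sequence of $k$ hyperplane splits of $P(M_1\oplus M_2)$; in particular, if the sequence for $P(M_1)$ yields $P(M_1)=\bigcup_{i=1}^{k+1}P(N_i)$, then the new one yields the decomposition $P(M_1\oplus M_2)=\bigcup_{i=1}^{k+1}P(N_i\oplus M_2)$. Likewise, replacing every piece $P(N)$ by $P(M_1\oplus N)$ turns a sequence of $k$ hyperplane splits of $P(M_2)$ into one of $P(M_1\oplus M_2)$. -/

import Mathlib

/-- The base polytope `P(M)`: the convex hull of the incidence vectors of the bases of `M`.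
For a matroid whose ground set is a subset of `α`, it lives in the coordinate subspace of
`α → ℝ` spanned by the coordinates in `M.E`. -/
def Matroid.basePolytope {α : Type*} (M : Matroid α) : Set (α → ℝ) :=
  convexHull ℝ ((fun B : Set α => B.indicator (fun _ => (1 : ℝ))) '' {B | M.IsBase B})

/-- `P(M) = ⋃ i, P(N i)` is a matroid base polytope decomposition, where `L` lists the `N i`:
they are matroids on the ground set of `M`, their base polytopes cover `P(M)`, and any two of
these (at different positions of the list) meet in a common face.  The faces of a polytope, the
empty face included, are its exposed subsets. -/
structure Matroid.IsBasePolytopeDecomposition {α : Type*} (M : Matroid α)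
    (L : List (Matroid α)) : Prop where
  ground_eq : ∀ N ∈ L, N.E = M.E
  eq_iUnion : M.basePolytope = ⋃ N ∈ L, N.basePolytope
  face : L.Pairwise fun N N' =>
    IsExposed ℝ N.basePolytope (N.basePolytope ∩ N'.basePolytope) ∧
    IsExposed ℝ N'.basePolytope (N.basePolytope ∩ N'.basePolytope)

/-- `P(M) = P(N₁) ∪ P(N₂)` is a hyperplane split: a decomposition into two pieces, neither of
which is all of `P(M)`. -/
structure Matroid.IsHyperplaneSplit {α : Type*} (M N₁ N₂ : Matroid α) : Prop where
  decomposition : M.IsBasePolytopeDecomposition [N₁, N₂]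
  left_ne : N₁.basePolytope ≠ M.basePolytope
  right_ne : N₂.basePolytope ≠ M.basePolytope

/-- The list `L'` arises from `L` by one hyperplane split of one of the pieces: one member `N`
of `L` is replaced by the two pieces of a hyperplane split of `P(N)`. -/
def Matroid.SplitStep {α : Type*} (L L' : List (Matroid α)) : Prop :=
  ∃ (A B : List (Matroid α)) (N N₁ N₂ : Matroid α),
    N.IsHyperplaneSplit N₁ N₂ ∧ L = A ++ N :: B ∧ L' = A ++ N₁ :: N₂ :: B

/-- `S 0, …, S k` is a sequence of `k ≥ 1` hyperplane splits of `P(M)`: it starts with the single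
piece `M`, each `S (j + 1)` arises from `S j` by a hyperplane split of one piece, and the pieces
obtained at the end form a matroid base polytope decomposition of `P(M)`. -/
structure Matroid.IsHyperplaneSplitSequence {α : Type*} (M : Matroid α) (k : ℕ)
    (S : Fin (k + 1) → List (Matroid α)) : Prop where
  pos : 1 ≤ k
  start : S 0 = [M]
  step : ∀ j : Fin k, Matroid.SplitStep (S j.castSucc) (S j.succ)
  decomposition : M.IsBasePolytopeDecomposition (S (Fin.last k))

/-- `P(M)` admits a sequence of hyperplane splits. -/
def Matroid.AdmitsHyperplaneSplitSequence {α : Type*} (M : Matroid α) : Prop :=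
  ∃ (k : ℕ) (S : Fin (k + 1) → List (Matroid α)), M.IsHyperplaneSplitSequence k S

/-- All pieces that occur in a sequence of hyperplane splits of `P(M)` are matroids on the ground
set of `M`. -/
theorem Matroid.IsHyperplaneSplitSequence.ground_eq {α : Type*} {M : Matroid α} {k : ℕ}
    {S : Fin (k + 1) → List (Matroid α)} (h : M.IsHyperplaneSplitSequence k S)
    (j : Fin (k + 1)) : ∀ N ∈ S j, N.E = M.E := by
  induction j using Fin.induction with
  | zero => simp [h.start]
  | succ j ih =>
    obtain ⟨A, B, N, N₁, N₂, hs, h₁, h₂⟩ := h.step j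
    rw [h₁] at ih
    rw [h₂]
    have hN : N.E = M.E := ih N (by simp)
    have e₁ := hs.decomposition.ground_eq N₁ (by simp)
    have e₂ := hs.decomposition.ground_eq N₂ (by simp)
    intro X hX
    simp only [List.mem_append, List.mem_cons] at hX
    rcases hX with hX | rfl | rfl | hX
    · exact ih X (by simp [hX])
    · exact e₁.trans hN
    · exact e₂.trans hN
    · exact ih X (by simp [hX])

/-- The list of the direct sums `N ⊕ M'` for the members `N` of a list `L` of matroids whose
ground sets equal `E`, where `E` is disjoint from the ground set of `M'`. -/
def Matroid.sumRight {α : Type*} {E : Set α} (L : List (Matroid α)) (hL : ∀ N ∈ L, N.E = E)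
    (M' : Matroid α) (hd : Disjoint E M'.E) : List (Matroid α) :=
  L.pmap (fun N hN => N.disjointSum M' (by rw [hN]; exact hd)) hL

/-- The list of the direct sums `M' ⊕ N` for the members `N` of a list `L` of matroids whose
ground sets equal `E`, where `E` is disjoint from the ground set of `M'`. -/
def Matroid.sumLeft {α : Type*} {E : Set α} (M' : Matroid α) (L : List (Matroid α))
    (hL : ∀ N ∈ L, N.E = E) (hd : Disjoint M'.E E) : List (Matroid α) :=
  L.pmap (fun N hN => M'.disjointSum N (by rw [hN]; exact hd)) hL

/-!
The base polytope of a direct sum is the Minkowski sum of the base polytopes of the summands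
(`Matroid.basePolytope_disjointSum`), and the two summands live in complementary sets of
coordinates.  So the projection `π` to the coordinates in `E₁` fixes `P(N)` pointwise, for each
matroid `N` on `E₁`, and sends all of `Q = P(M₂)` to zero.

Everything else is a statement about the operation `A ↦ A + Q` on sets `A` that `π` fixes
pointwise, for a nonempty `Q` killed by `π`.  It commutes with unions; it commutes with
intersections and is injective because `π` recovers the summand in `A` from a point of `A + Q`
(`Set.inter_add_of_eqOn`, `Set.image_add_of_eqOn`); and it sends faces to faces, since a functional
`l` exposing `F` in `A` yields the functional `l ∘ π` exposing `F + Q` in `A + Q`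
(`IsExposed.add_of_eqOn`).  Hence it preserves decompositions and hyperplane splits, step by step
along a sequence of splits.  The statement for the second summand is the one for the first, since
the direct sum is commutative.
-/

open scoped Pointwise

section Projection

variable {V : Type*} [AddCommGroup V] [Module ℝ V]

lemma Set.image_add_of_eqOn {π : V →ₗ[ℝ] V} {A Q : Set V} (hA : ∀ a ∈ A, π a = a)
    (hQ : ∀ q ∈ Q, π q = 0) (hne : Q.Nonempty) : π '' (A + Q) = A := by
  rw [Set.image_add, Set.image_congr hA, Set.image_congr hQ, hne.image_const]
  simp

lemma Set.inter_add_of_eqOn {π : V →ₗ[ℝ] V} {A A' Q : Set V} (hA : ∀ a ∈ A, π a = a)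
    (hA' : ∀ a ∈ A', π a = a) (hQ : ∀ q ∈ Q, π q = 0) :
    A ∩ A' + Q = (A + Q) ∩ (A' + Q) := by
  refine Set.Subset.antisymm Set.inter_add_subset ?_
  rintro x ⟨⟨a, ha, q, hq, rfl⟩, ⟨a', ha', q', hq', h⟩⟩
  have h' := congrArg π h
  simp only [map_add, hA a ha, hA' a' ha', hQ q hq, hQ q' hq', add_zero] at h'
  exact ⟨a, ⟨ha, h' ▸ ha'⟩, q, hq, rfl⟩

/-- If `l` exposes `F` in `A`, then `l ∘ π` exposes `F + Q` in `A + Q`.  If `F` or `Q` is empty,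
then so is `F + Q`, which counts as exposed. -/
lemma IsExposed.add_of_eqOn [TopologicalSpace V] {π : V →L[ℝ] V} {A F Q : Set V}
    (hF : IsExposed ℝ A F) (hA : ∀ a ∈ A, π a = a) (hQ : ∀ q ∈ Q, π q = 0) :
    IsExposed ℝ (A + Q) (F + Q) := by
  rintro ⟨_, f₀, hf₀, q₀, hq₀, -⟩
  obtain ⟨l, rfl⟩ := hF ⟨f₀, hf₀⟩
  have hπ : ∀ a ∈ A, ∀ q ∈ Q, (l.comp π) (a + q) = l a := fun a ha q hq => by
    simp [hA a ha, hQ q hq]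
  refine ⟨l.comp π, Set.Subset.antisymm ?_ ?_⟩
  · rintro _ ⟨a, ⟨ha, hmax⟩, q, hq, rfl⟩
    refine ⟨Set.add_mem_add ha hq, ?_⟩
    rintro _ ⟨b, hb, r, hr, rfl⟩
    simpa only [hπ a ha q hq, hπ b hb r hr] using hmax b hb
  · rintro _ ⟨⟨a, ha, q, hq, rfl⟩, hmax⟩
    refine ⟨a, ⟨ha, fun b hb => ?_⟩, q, hq, rfl⟩
    simpa only [hπ a ha q hq, hπ b hb q hq] using hmax (b + q) (Set.add_mem_add hb hq)

end Projection

namespace Matroid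

variable {α : Type*} {E : Set α} {M N N₁ N₂ M' : Matroid α}

lemma basePolytope_nonempty (M : Matroid α) : M.basePolytope.Nonempty := by
  obtain ⟨B, hB⟩ := M.exists_isBase
  exact ⟨_, subset_convexHull ℝ _ ⟨B, hB, rfl⟩⟩

lemma basePolytope_disjointSum (M N : Matroid α) (hd : Disjoint M.E N.E) :
    (M.disjointSum N hd).basePolytope = M.basePolytope + N.basePolytope := by
  rw [basePolytope, basePolytope, basePolytope, ← convexHull_add]
  congr 1
  ext x
  simp only [Set.mem_add, Set.mem_image, Set.mem_ofPred_eq]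
  constructor
  · rintro ⟨B, hB, rfl⟩
    rw [disjointSum_isBase_iff] at hB
    refine ⟨_, ⟨_, hB.1, rfl⟩, _, ⟨_, hB.2.1, rfl⟩, ?_⟩
    refine (Set.indicator_union_of_disjoint (hd.mono Set.inter_subset_right
      Set.inter_subset_right) (fun _ => (1 : ℝ))).symm.trans ?_
    rw [← Set.inter_union_distrib_left, Set.inter_eq_left.2 hB.2.2]
  · rintro ⟨_, ⟨B, hB, rfl⟩, _, ⟨C, hC, rfl⟩, rfl⟩
    refine ⟨B ∪ C, ?_, Set.indicator_union_of_disjoint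
      (hd.mono hB.subset_ground hC.subset_ground) _⟩
    rw [disjointSum_isBase_iff, Set.union_inter_distrib_right, Set.union_inter_distrib_right,
      Set.inter_eq_left.2 hB.subset_ground, Set.inter_eq_left.2 hC.subset_ground,
      (hd.mono_left hB.subset_ground).inter_eq, (hd.symm.mono_left hC.subset_ground).inter_eq,
      Set.union_empty, Set.empty_union]
    exact ⟨hB, hC, Set.union_subset_union hB.subset_ground hC.subset_ground⟩

lemma apply_eq_zero_of_mem_basePolytope {x : α → ℝ} (hx : x ∈ M.basePolytope) {i : α}
    (hi : i ∉ M.E) : x i = 0 := by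
  have hsub : M.basePolytope ⊆ (LinearMap.ker (LinearMap.proj (R := ℝ) (φ := fun _ : α => ℝ) i) :
      Set (α → ℝ)) := by
    refine convexHull_min ?_ (Submodule.convex _)
    rintro _ ⟨B, hB, rfl⟩
    have : i ∉ B := fun h => hi (IsBase.subset_ground hB h)
    simp [this]
  simpa using hsub hx

open Classical in
/-- The projection of `α → ℝ` to the coordinates in `E`: it sets all other coordinates to zero. -/
noncomputable def coordProj (E : Set α) : (α → ℝ) →L[ℝ] (α → ℝ) :=
  ContinuousLinearMap.pi fun i => if i ∈ E then ContinuousLinearMap.proj i else 0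

lemma coordProj_eq_self (hE : M.E = E) : ∀ x ∈ M.basePolytope, coordProj E x = x := by
  intro x hx
  ext i
  by_cases hi : i ∈ E
  · simp [coordProj, hi]
  · simp [coordProj, hi, apply_eq_zero_of_mem_basePolytope hx (hE ▸ hi)]

lemma coordProj_eq_zero (hd : Disjoint E M.E) : ∀ x ∈ M.basePolytope, coordProj E x = 0 := by
  intro x hx
  ext i
  by_cases hi : i ∈ E
  · simp [coordProj, hi, apply_eq_zero_of_mem_basePolytope hx (hd.notMem_of_mem_left hi)]
  · simp [coordProj, hi]

lemma IsBasePolytopeDecomposition.sumRight {L : List (Matroid α)}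
    (h : M.IsBasePolytopeDecomposition L) (hM : M.E = E) (hL : ∀ N ∈ L, N.E = E)
    (hd : Disjoint E M'.E) :
    (M.disjointSum M' (hM ▸ hd)).IsBasePolytopeDecomposition (sumRight L hL M' hd) where
  ground_eq := by
    intro X hX
    obtain ⟨N, hN, rfl⟩ := List.mem_pmap.1 hX
    simp [hM, hL N hN]
  eq_iUnion := by
    rw [basePolytope_disjointSum, h.eq_iUnion, Set.iUnion₂_add]
    ext x
    simp only [Matroid.sumRight, Set.mem_iUnion, List.mem_pmap, exists_prop]
    constructor
    · rintro ⟨N, hN, hx⟩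
      exact ⟨_, ⟨N, hN, rfl⟩, by rwa [basePolytope_disjointSum]⟩
    · rintro ⟨_, ⟨N, hN, rfl⟩, hx⟩
      exact ⟨N, hN, by rwa [basePolytope_disjointSum] at hx⟩
  face := by
    rw [Matroid.sumRight, List.pairwise_pmap]
    refine h.face.imp fun {N N'} hf hN hN' => ?_
    have hQ := coordProj_eq_zero hd
    rw [basePolytope_disjointSum, basePolytope_disjointSum,
      ← Set.inter_add_of_eqOn (π := (coordProj E).toLinearMap) (coordProj_eq_self hN)
        (coordProj_eq_self hN') hQ]
    exact ⟨hf.1.add_of_eqOn (coordProj_eq_self hN) hQ, hf.2.add_of_eqOn (coordProj_eq_self hN') hQ⟩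

lemma basePolytope_eq_of_disjointSum_eq (hM : M.E = E) (hN : N.E = E) (hd : Disjoint E M'.E)
    (h : (M.disjointSum M' (hM ▸ hd)).basePolytope = (N.disjointSum M' (hN ▸ hd)).basePolytope) :
    M.basePolytope = N.basePolytope := by
  rw [basePolytope_disjointSum, basePolytope_disjointSum] at h
  have hQ := coordProj_eq_zero hd
  rw [← Set.image_add_of_eqOn (π := (coordProj E).toLinearMap) (coordProj_eq_self hM) hQ
    M'.basePolytope_nonempty, h, Set.image_add_of_eqOn (π := (coordProj E).toLinearMap)
    (coordProj_eq_self hN) hQ M'.basePolytope_nonempty]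

lemma IsHyperplaneSplit.disjointSum (h : N.IsHyperplaneSplit N₁ N₂) (hN : N.E = E)
    (h₁ : N₁.E = E) (h₂ : N₂.E = E) (hd : Disjoint E M'.E) :
    (N.disjointSum M' (hN ▸ hd)).IsHyperplaneSplit (N₁.disjointSum M' (h₁ ▸ hd))
      (N₂.disjointSum M' (h₂ ▸ hd)) where
  decomposition := h.decomposition.sumRight hN (by simp [h₁, h₂]) hd
  left_ne he := h.left_ne (basePolytope_eq_of_disjointSum_eq h₁ hN hd he)
  right_ne he := h.right_ne (basePolytope_eq_of_disjointSum_eq h₂ hN hd he)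

lemma SplitStep.sumRight {L L' : List (Matroid α)} (h : SplitStep L L') (hL : ∀ N ∈ L, N.E = E)
    (hL' : ∀ N ∈ L', N.E = E) (hd : Disjoint E M'.E) :
    SplitStep (sumRight L hL M' hd) (sumRight L' hL' M' hd) := by
  obtain ⟨A, B, N, N₁, N₂, hs, rfl, rfl⟩ := h
  refine ⟨Matroid.sumRight A (fun X hX => hL X (by simp [hX])) M' hd,
    Matroid.sumRight B (fun X hX => hL X (by simp [hX])) M' hd, _, _, _,
    hs.disjointSum (hL N (by simp)) (hL' N₁ (by simp)) (hL' N₂ (by simp)) hd, ?_, ?_⟩ <;>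
  simp [Matroid.sumRight, List.pmap_append]

lemma IsHyperplaneSplitSequence.sumRight {k : ℕ} {S : Fin (k + 1) → List (Matroid α)}
    (hS : M.IsHyperplaneSplitSequence k S) (hd : Disjoint M.E M'.E) :
    (M.disjointSum M' hd).IsHyperplaneSplitSequence k
      (fun j => Matroid.sumRight (S j) (hS.ground_eq j) M' hd) where
  pos := hS.pos
  start := by simp [Matroid.sumRight, hS.start]
  step j := (hS.step j).sumRight _ _ hd
  decomposition := hS.decomposition.sumRight rfl _ hd

lemma sumLeft_eq_sumRight (L : List (Matroid α)) (hL : ∀ N ∈ L, N.E = E)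
    (hd : Disjoint M'.E E) : sumLeft M' L hL hd = sumRight L hL M' hd.symm :=
  List.pmap_congr_left _ fun _ _ _ _ => disjointSum_comm

lemma IsHyperplaneSplitSequence.sumLeft {k : ℕ} {S : Fin (k + 1) → List (Matroid α)}
    (hS : M.IsHyperplaneSplitSequence k S) (hd : Disjoint M'.E M.E) :
    (M'.disjointSum M hd).IsHyperplaneSplitSequence k
      (fun j => Matroid.sumLeft M' (S j) (hS.ground_eq j) hd) := by
  simp only [sumLeft_eq_sumRight]
  rw [disjointSum_comm]
  exact hS.sumRight hd.symm

end Matroid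

/-- If `P(M₁)` or `P(M₂)` admits a sequence of hyperplane splits, so does `P(M₁ ⊕ M₂)`; more
precisely, adding the other summand to every piece, at every stage of a sequence of hyperplane
splits for one summand, gives a sequence of hyperplane splits of `P(M₁ ⊕ M₂)`. -/
theorem theorem4 {α : Type*} (M₁ M₂ : Matroid α) [M₁.Finite] [M₂.Finite]
    (hd : Disjoint M₁.E M₂.E) :
    (M₁.AdmitsHyperplaneSplitSequence ∨ M₂.AdmitsHyperplaneSplitSequence →
      (M₁.disjointSum M₂ hd).AdmitsHyperplaneSplitSequence) ∧
    (∀ (k : ℕ) (S : Fin (k + 1) → List (Matroid α)) (hS : M₁.IsHyperplaneSplitSequence k S),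
      (M₁.disjointSum M₂ hd).IsHyperplaneSplitSequence k
        (fun j => Matroid.sumRight (S j) (hS.ground_eq j) M₂ hd)) ∧
    (∀ (k : ℕ) (S : Fin (k + 1) → List (Matroid α)) (hS : M₂.IsHyperplaneSplitSequence k S),
      (M₁.disjointSum M₂ hd).IsHyperplaneSplitSequence k
        (fun j => Matroid.sumLeft M₁ (S j) (hS.ground_eq j) hd)) := by
  refine ⟨?_, fun k S hS => hS.sumRight hd, fun k S hS => hS.sumLeft hd⟩
  rintro (⟨k, S, hS⟩ | ⟨k, S, hS⟩)
  · exact ⟨k, _, hS.sumRight hd⟩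
  · exact ⟨k, _, hS.sumLeft hd⟩
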